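/- Let $1 \le l \le m$ and $n \ge 0$ be integers, let $A \in \mathbb{R}^{m\times n}$ be a fixed matrix, and let $G$ be an $l\times m$ standard Gaussian random matrix, i.e. its entries are independent $N(0,1)$ random variables. Let $\|\cdot\|$ denote the spectral norm of a matrix (the operator norm with respect to the Euclidean norms). Then $\left\|\tfrac1l G^\top G A - A\right\|$ is integrable and $$\mathbb{E}\left\|\tfrac1l G^\top G A - A\right\| \;\ge\; \sqrt{\frac{m-l}{m+1}}\;\|A\|.$$ Moreover, when $l \ll m$ this lower bound is approximately $\|A\|$: for every $\varepsilon>0$ there is $\delta>0$ such that for all integers $l \ge 1$, $m$ and $n\ge 0$ with $l \le \delta m$ and all $A \in \mathbb{R}^{m\times n}$, $$\left|\sqrt{\frac{m-l}{m+1}}\;\|A\| - \|A\|\right| \le \varepsilon \|A\|.$$ -/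

import Mathlib

open MeasureTheory ProbabilityTheory
-- `‖·‖` on matrices is the spectral norm (the operator norm for Euclidean norms).
open scoped Matrix Matrix.Norms.L2Operator

/-- A random real `l × m` matrix on the probability space `(Ω, P)` is standard Gaussian if its
entries are independent standard normal random variables. -/
structure IsStandardGaussianMatrix {Ω : Type*} [MeasurableSpace Ω] (P : Measure Ω) {l m : ℕ}
    (G : Ω → Matrix (Fin l) (Fin m) ℝ) : Prop where
  hasLaw_entry : ∀ i j, HasLaw (fun ω => G ω i j) (gaussianReal 0 1) P
  indep_entries : iIndepFun (fun (p : Fin l × Fin m) (ω : Ω) => G ω p.1 p.2) P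

/-! Write D for the deviation matrix and M for the number of rows of A. Fix v, put x = Av, and take
M - 1 orthonormal vectors e_j orthogonal to x. The term -A drops out of ⟨e_j, Dv⟩, which equals ⟨Gx,
Ge_j⟩/l, and Cauchy-Schwarz with Bessel gives ∑ |⟨e_j, Dv⟩| ≤ √(M-1) ‖D‖ ‖v‖. Since x ⟂ e_j, the
Gaussian vectors Gx and Ge_j are independent; conditioning on Gx gives E|⟨Gx, Ge_j⟩| = √(2/π) E‖Gx‖
≥ (2/π) √l ‖x‖ (`sqrt_mul_le_integral_abs_dotProduct`). Summing over j yields E‖D‖ ≥ (2/π)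
√((M-1)/l) ‖A‖, and this constant dominates √((M-l)/(M+1)). Only first moments are used, no chi or
Beta laws. -/

/-- The absolute first moment of the standard normal law. -/
lemma integral_abs_gaussianReal_zero_one : ∫ x, |x| ∂gaussianReal 0 1 = √(2 / Real.pi) := by
  have h1 := integral_rpow_mul_exp_neg_mul_rpow (p := 2) (q := 1) (b := 1 / 2)
    (by norm_num) (by norm_num) (by norm_num)
  have h2 : ∫ x in Set.Ioi (0 : ℝ), x * Real.exp (-x ^ 2 / 2) = 1 := by
    rw [← setIntegral_congr_fun measurableSet_Ioi
      (f := fun x : ℝ => x ^ (1 : ℝ) * Real.exp (-(1 / 2) * x ^ (2 : ℝ))) (fun x _ => ?_), h1]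
    · norm_num [Real.rpow_neg_one]
    · simp only [Real.rpow_one, Real.rpow_two]
      congr 2
      ring
  rw [integral_gaussianReal_eq_integral_smul one_ne_zero]
  have h3 : ∀ x : ℝ, gaussianPDFReal 0 1 x • |x|
      = (√(2 * Real.pi))⁻¹ * (fun y : ℝ => y * Real.exp (-y ^ 2 / 2)) |x| := fun x => by
    simp only [gaussianPDFReal, NNReal.coe_one, smul_eq_mul, sub_zero, mul_one, sq_abs]
    ring
  simp_rw [h3]
  rw [integral_const_mul, integral_comp_abs (f := fun y : ℝ => y * Real.exp (-y ^ 2 / 2)), h2,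
    Real.sqrt_div zero_le_two, Real.sqrt_mul zero_le_two]
  have : √2 * √2 = 2 := Real.mul_self_sqrt zero_le_two
  have h2' : √2 ≠ 0 := by positivity
  have hp : √Real.pi ≠ 0 := by have := Real.pi_pos; positivity
  field_simp
  linarith

/-! ### Moments and independence of images under a Gaussian matrix. -/

section Gaussian

variable {Ω : Type*} [MeasurableSpace Ω] {P : Measure Ω}

/-- The absolute first moment of a centred Gaussian variable. -/
lemma ProbabilityTheory.HasGaussianLaw.integral_abs {X : Ω → ℝ} (hX : HasGaussianLaw X P)
    (h0 : P[X] = 0) : ∫ ω, |X ω| ∂P = √(2 / Real.pi) * √(Var[X; P]) := by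
  have h1 : P.map X = (gaussianReal 0 1).map (√(Var[X; P]) * ·) := by
    rw [hX.map_eq_gaussianReal, h0, gaussianReal_map_const_mul]
    congr 1
    · simp
    · ext
      simp [variance_nonneg]
  have h2 : ∫ ω, |X ω| ∂P = ∫ x, |x| ∂(P.map X) := by
    rw [integral_map hX.aemeasurable (by fun_prop)]
  rw [h2, h1, integral_map (by fun_prop) (by fun_prop)]
  simp_rw [abs_mul, abs_of_nonneg (Real.sqrt_nonneg _)]
  rw [integral_const_mul, integral_abs_gaussianReal_zero_one, mul_comm]

variable {l m : ℕ} {G : Ω → Matrix (Fin l) (Fin m) ℝ}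

namespace IsStandardGaussianMatrix

lemma hasGaussianLaw_entry (hG : IsStandardGaussianMatrix P G) (i : Fin l) (j : Fin m) :
    HasGaussianLaw (fun ω => G ω i j) P :=
  (hG.hasLaw_entry i j).hasGaussianLaw

lemma integral_entry (hG : IsStandardGaussianMatrix P G) (i : Fin l) (j : Fin m) :
    ∫ ω, G ω i j ∂P = 0 := by
  rw [(hG.hasLaw_entry i j).integral_eq, integral_id_gaussianReal]

lemma covariance_entry (hG : IsStandardGaussianMatrix P G) (i i' : Fin l) (j j' : Fin m) :
    cov[fun ω => G ω i j, fun ω => G ω i' j'; P] = if i = i' ∧ j = j' then 1 else 0 := by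
  split_ifs with h
  · obtain ⟨rfl, rfl⟩ := h
    rw [covariance_self (hG.hasGaussianLaw_entry i j).aemeasurable,
      (hG.hasLaw_entry i j).variance_eq, variance_id_gaussianReal, NNReal.coe_one]
  · exact (hG.indep_entries.indepFun (i := (i, j)) (j := (i', j'))
      (by simpa [Prod.ext_iff] using h)).covariance_eq_zero
      (hG.hasGaussianLaw_entry i j).memLp_two (hG.hasGaussianLaw_entry i' j').memLp_two

lemma hasGaussianLaw_entries (hG : IsStandardGaussianMatrix P G) :
    HasGaussianLaw (fun ω (p : Fin l × Fin m) => G ω p.1 p.2) P :=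
  hG.indep_entries.hasGaussianLaw fun p => hG.hasGaussianLaw_entry p.1 p.2

/-- The images of two fixed vectors under a Gaussian matrix are jointly Gaussian. -/
lemma hasGaussianLaw_mulVec_prodMk (hG : IsStandardGaussianMatrix P G) (x y : Fin m → ℝ) :
    HasGaussianLaw (fun ω => (fun i => (G ω *ᵥ x) i, fun i => (G ω *ᵥ y) i)) P := by
  let T : (Fin m → ℝ) → (Fin l × Fin m → ℝ) →L[ℝ] (Fin l → ℝ) := fun z =>
    ContinuousLinearMap.pi fun i => ∑ j, z j • ContinuousLinearMap.proj (i, j)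
  have h := hG.hasGaussianLaw_entries.map_fun ((T x).prod (T y))
  refine h.congr (ae_of_all _ fun ω => Prod.ext ?_ ?_) <;> ext i <;>
    simp [T, Matrix.mulVec, dotProduct, mul_comm]

lemma hasGaussianLaw_mulVec_apply (hG : IsStandardGaussianMatrix P G) (x : Fin m → ℝ)
    (i : Fin l) : HasGaussianLaw (fun ω => (G ω *ᵥ x) i) P :=
  (hG.hasGaussianLaw_mulVec_prodMk x x).fst.map_fun (ContinuousLinearMap.proj (R := ℝ) i)

lemma integral_mulVec_apply (hG : IsStandardGaussianMatrix P G) (x : Fin m → ℝ) (i : Fin l) :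
    ∫ ω, (G ω *ᵥ x) i ∂P = 0 := by
  simp only [Matrix.mulVec, dotProduct]
  rw [integral_finsetSum _ fun j _ => (hG.hasGaussianLaw_entry i j).integrable.mul_const _]
  simp [integral_mul_const, hG.integral_entry]

lemma covariance_mulVec_apply (hG : IsStandardGaussianMatrix P G) (x y : Fin m → ℝ)
    (i i' : Fin l) :
    cov[fun ω => (G ω *ᵥ x) i, fun ω => (G ω *ᵥ y) i'; P] = if i = i' then x ⬝ᵥ y else 0 := by
  have := hG.hasGaussianLaw_entries.isProbabilityMeasure
  simp only [Matrix.mulVec, dotProduct]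
  rw [covariance_fun_sum_fun_sum
    (fun j => (hG.hasGaussianLaw_entry i j).memLp_two.mul_const _)
    (fun j => (hG.hasGaussianLaw_entry i' j).memLp_two.mul_const _)]
  simp only [covariance_mul_const_left, covariance_mul_const_right, hG.covariance_entry]
  split_ifs with h <;> simp [h, mul_comm]

lemma integral_abs_mulVec_apply (hG : IsStandardGaussianMatrix P G) (x : Fin m → ℝ)
    (i : Fin l) : ∫ ω, |(G ω *ᵥ x) i| ∂P = √(2 / Real.pi) * √(x ⬝ᵥ x) := by
  rw [(hG.hasGaussianLaw_mulVec_apply x i).integral_abs (hG.integral_mulVec_apply x i),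
    ← covariance_self (hG.hasGaussianLaw_mulVec_apply x i).aemeasurable,
    hG.covariance_mulVec_apply, if_pos rfl]

/-- Orthogonal vectors have independent images under a Gaussian matrix. -/
lemma indepFun_mulVec (hG : IsStandardGaussianMatrix P G) {x y : Fin m → ℝ} (hxy : x ⬝ᵥ y = 0) :
    IndepFun (fun ω => G ω *ᵥ x) (fun ω => G ω *ᵥ y) P :=
  (hG.hasGaussianLaw_mulVec_prodMk x y).indepFun_of_covariance_eval fun i j => by
    rw [hG.covariance_mulVec_apply, hxy, ite_self]

/-- The coordinates of Gy are uncorrelated with variance |y|², so ⟨a, Gy⟩ is a centred Gaussian of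
variance |a|²|y|². -/
lemma integral_abs_dotProduct_mulVec (hG : IsStandardGaussianMatrix P G) (a : Fin l → ℝ)
    (y : Fin m → ℝ) :
    ∫ ω, |a ⬝ᵥ (G ω *ᵥ y)| ∂P = √(2 / Real.pi) * (√(a ⬝ᵥ a) * √(y ⬝ᵥ y)) := by
  have := hG.hasGaussianLaw_entries.isProbabilityMeasure
  have h1 : HasGaussianLaw (fun ω => a ⬝ᵥ (G ω *ᵥ y)) P := by
    have h := (hG.hasGaussianLaw_mulVec_prodMk y y).fst.map_fun
      (∑ i, a i • ContinuousLinearMap.proj (R := ℝ) (φ := fun _ : Fin l => ℝ) i)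
    exact h.congr (ae_of_all _ fun ω => by simp [dotProduct])
  have h2 : ∫ ω, a ⬝ᵥ (G ω *ᵥ y) ∂P = 0 := by
    change ∫ ω, ∑ i, a i * (G ω *ᵥ y) i ∂P = 0
    rw [integral_finsetSum _ fun i _ =>
      (hG.hasGaussianLaw_mulVec_apply y i).integrable.const_mul _]
    simp [integral_const_mul, hG.integral_mulVec_apply]
  have h3 : Var[fun ω => a ⬝ᵥ (G ω *ᵥ y); P] = (a ⬝ᵥ a) * (y ⬝ᵥ y) := by
    rw [← covariance_self h1.aemeasurable]
    change cov[fun ω => ∑ i, a i * (G ω *ᵥ y) i, fun ω => ∑ i, a i * (G ω *ᵥ y) i; P] = _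
    rw [covariance_fun_sum_fun_sum
      (fun i => (hG.hasGaussianLaw_mulVec_apply y i).memLp_two.const_mul _)
      (fun i => (hG.hasGaussianLaw_mulVec_apply y i).memLp_two.const_mul _)]
    simp [covariance_const_mul_left, covariance_const_mul_right, hG.covariance_mulVec_apply,
      ← mul_assoc, ← Finset.sum_mul]
    exact Or.inl rfl
  rw [h1.integral_abs h2, h3, Real.sqrt_mul (by simpa using dotProduct_star_self_nonneg a)]

lemma integrable_mulVec_dotProduct_mulVec (hG : IsStandardGaussianMatrix P G)
    (x y : Fin m → ℝ) : Integrable (fun ω => (G ω *ᵥ x) ⬝ᵥ (G ω *ᵥ y)) P := by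
  simp only [dotProduct]
  exact integrable_finsetSum _ fun i _ =>
    (hG.hasGaussianLaw_mulVec_apply x i).memLp_two.integrable_mul
      (hG.hasGaussianLaw_mulVec_apply y i).memLp_two

/-- Independence and Fubini allow integrating over Gy with Gx frozen, which leaves E‖Gx‖; this is
bounded below through the ℓ¹ norm. -/
lemma sqrt_mul_le_integral_abs_dotProduct (hG : IsStandardGaussianMatrix P G) {x y : Fin m → ℝ}
    (hxy : x ⬝ᵥ y = 0) :
    2 / Real.pi * √l * (√(x ⬝ᵥ x) * √(y ⬝ᵥ y)) ≤ ∫ ω, |(G ω *ᵥ x) ⬝ᵥ (G ω *ᵥ y)| ∂P := by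
  have := hG.hasGaussianLaw_entries.isProbabilityMeasure
  have hX : AEMeasurable (fun ω => G ω *ᵥ x) P :=
    (hG.hasGaussianLaw_mulVec_prodMk x y).fst.aemeasurable
  have hY : AEMeasurable (fun ω => G ω *ᵥ y) P :=
    (hG.hasGaussianLaw_mulVec_prodMk x y).snd.aemeasurable
  have hmap := (hG.indepFun_mulVec hxy).map_prod_eq_prod_map_map hX hY
  have hF : Continuous fun p : (Fin l → ℝ) × (Fin l → ℝ) => |p.1 ⬝ᵥ p.2| := by
    simp only [dotProduct]; fun_prop
  have hint : Integrable (fun p : (Fin l → ℝ) × (Fin l → ℝ) => |p.1 ⬝ᵥ p.2|)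
      ((P.map fun ω => G ω *ᵥ x).prod (P.map fun ω => G ω *ᵥ y)) := by
    rw [← hmap, integrable_map_measure hF.aestronglyMeasurable (hX.prodMk hY)]
    exact (hG.integrable_mulVec_dotProduct_mulVec x y).abs
  have h1 : ∫ ω, |(G ω *ᵥ x) ⬝ᵥ (G ω *ᵥ y)| ∂P
      = ∫ ω, √(2 / Real.pi) * (√((G ω *ᵥ x) ⬝ᵥ (G ω *ᵥ x)) * √(y ⬝ᵥ y)) ∂P := by
    calc _ = ∫ p, |p.1 ⬝ᵥ p.2| ∂(P.map fun ω => (G ω *ᵥ x, G ω *ᵥ y)) := by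
          rw [integral_map (hX.prodMk hY) hF.aestronglyMeasurable]
      _ = ∫ a, ∫ b, |a ⬝ᵥ b| ∂(P.map fun ω => G ω *ᵥ y) ∂(P.map fun ω => G ω *ᵥ x) := by
          rw [hmap, integral_prod _ hint]
      _ = ∫ a, √(2 / Real.pi) * (√(a ⬝ᵥ a) * √(y ⬝ᵥ y)) ∂(P.map fun ω => G ω *ᵥ x) := by
          congr 1 with a
          have ha : Continuous fun b => |a ⬝ᵥ b| := hF.comp (Continuous.prodMk_right a)
          rw [integral_map hY ha.aestronglyMeasurable, hG.integral_abs_dotProduct_mulVec]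
      _ = _ := by rw [integral_map hX (by simp only [dotProduct]; fun_prop)]
  -- Cauchy-Schwarz: ‖·‖₁ ≤ √l ‖·‖₂, and the ℓ¹ norm has an explicit mean.
  have h2 : ∀ ω, ∑ i, |(G ω *ᵥ x) i| ≤ √l * √((G ω *ᵥ x) ⬝ᵥ (G ω *ᵥ x)) := fun ω => by
    rw [← Real.sqrt_mul (Nat.cast_nonneg l)]
    refine Real.le_sqrt_of_sq_le (sq_sum_le_card_mul_sum_sq.trans_eq ?_)
    simp [dotProduct, sq]
  have hi : ∀ i, Integrable (fun ω => |(G ω *ᵥ x) i|) P := fun i =>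
    (hG.hasGaussianLaw_mulVec_apply x i).integrable.abs
  have hs : Integrable (fun ω => √((G ω *ᵥ x) ⬝ᵥ (G ω *ᵥ x))) P := by
    refine (integrable_finsetSum Finset.univ fun i _ => hi i).mono' ?_ (ae_of_all _ fun ω => ?_)
    · exact ((by simp only [dotProduct]; fun_prop :
        Continuous fun a : Fin l → ℝ => √(a ⬝ᵥ a)).comp_aestronglyMeasurable
          hX.aestronglyMeasurable)
    · rw [Real.norm_of_nonneg (Real.sqrt_nonneg _)]
      refine Real.sqrt_le_iff.2 ⟨by positivity, ?_⟩
      simp only [dotProduct, ← sq, ← sq_abs ((G ω *ᵥ x) _)]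
      exact Finset.sum_sq_le_sq_sum_of_nonneg fun i _ => abs_nonneg _
  have h3 : l * (√(2 / Real.pi) * √(x ⬝ᵥ x)) ≤ √l * ∫ ω, √((G ω *ᵥ x) ⬝ᵥ (G ω *ᵥ x)) ∂P := by
    rw [← integral_const_mul]
    refine le_trans (le_of_eq ?_) (integral_mono (integrable_finsetSum Finset.univ fun i _ => hi i)
      (hs.const_mul _) h2)
    rw [integral_finsetSum _ fun i _ => hi i]
    simp [hG.integral_abs_mulVec_apply]
  rw [h1, integral_const_mul, integral_mul_const]
  rcases Nat.eq_zero_or_pos l with rfl | hl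
  · simp
  have hl' : 0 < √(l : ℝ) := Real.sqrt_pos.2 (by exact_mod_cast hl)
  have hll : √(l : ℝ) * √l = l := Real.mul_self_sqrt (Nat.cast_nonneg l)
  have h4 : √l * (√(2 / Real.pi) * √(x ⬝ᵥ x)) ≤ ∫ ω, √((G ω *ᵥ x) ⬝ᵥ (G ω *ᵥ x)) ∂P := by
    refine le_of_mul_le_mul_left ?_ hl'
    rwa [← mul_assoc, hll]
  have hpi : √(2 / Real.pi) * √(2 / Real.pi) = 2 / Real.pi :=
    Real.mul_self_sqrt (by have := Real.pi_pos; positivity)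
  calc _ = √(2 / Real.pi) * ((√l * (√(2 / Real.pi) * √(x ⬝ᵥ x))) * √(y ⬝ᵥ y)) := by
        linear_combination (-(√l * √(x ⬝ᵥ x) * √(y ⬝ᵥ y))) * hpi
    _ ≤ _ := by gcongr

end IsStandardGaussianMatrix

end Gaussian

/-! ### From inner products to the spectral norm of the deviation. -/

section Deviation

variable {Ω : Type*} [MeasurableSpace Ω] {P : Measure Ω} {l m n : ℕ}
  {G : Ω → Matrix (Fin l) (Fin m) ℝ}

lemma integrable_matrix_of_entries {M : Ω → Matrix (Fin m) (Fin n) ℝ}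
    (hM : ∀ i j, Integrable (fun ω => M ω i j) P) : Integrable M P := by
  have h : M = fun ω => ∑ i, ∑ j, M ω i j • Matrix.single i j (1 : ℝ) := by
    ext1 ω
    conv_lhs => rw [Matrix.matrix_eq_sum_single (M ω)]
    simp
  rw [h]
  exact integrable_finsetSum _ fun i _ => integrable_finsetSum _ fun j _ =>
    (hM i j).smul_const _

lemma IsStandardGaussianMatrix.integrable_deviation (hG : IsStandardGaussianMatrix P G)
    (c : ℝ) (A : Matrix (Fin m) (Fin n) ℝ) :
    Integrable (fun ω => c • ((G ω)ᵀ * G ω * A) - A) P := by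
  have := hG.hasGaussianLaw_entries.isProbabilityMeasure
  refine integrable_matrix_of_entries fun i j => ?_
  simp only [Matrix.sub_apply, Matrix.smul_apply, Matrix.mul_apply, Matrix.transpose_apply]
  refine ((integrable_finsetSum _ fun k _ => ?_).smul c).sub (integrable_const _)
  exact (integrable_finsetSum _ fun p _ => (hG.hasGaussianLaw_entry p i).memLp_two.integrable_mul
    (hG.hasGaussianLaw_entry p k).memLp_two).mul_const _

/-- Cauchy-Schwarz on the sum, then Bessel's inequality. -/
lemma sum_abs_inner_le {E ι : Type*} [NormedAddCommGroup E] [InnerProductSpace ℝ E] [Fintype ι]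
    {e : ι → E} (he : Orthonormal ℝ e) (z : E) :
    ∑ i, |inner ℝ (e i) z| ≤ √(Fintype.card ι) * ‖z‖ := by
  refine abs_le_of_sq_le_sq' ?_ (by positivity) |>.2
  rw [mul_pow, Real.sq_sqrt (Nat.cast_nonneg _)]
  refine sq_sum_le_card_mul_sum_sq.trans ?_
  rw [Finset.card_univ]
  gcongr
  exact he.sum_inner_products_le z

lemma exists_orthonormal_orthogonal {m : ℕ} (x : EuclideanSpace ℝ (Fin (m + 1))) :
    ∃ e : Fin m → EuclideanSpace ℝ (Fin (m + 1)),
      Orthonormal ℝ e ∧ ∀ j, inner ℝ (e j) x = 0 := by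
  have key : ∀ x : EuclideanSpace ℝ (Fin (m + 1)), x ≠ 0 →
      ∃ e : Fin m → EuclideanSpace ℝ (Fin (m + 1)),
        Orthonormal ℝ e ∧ ∀ j, inner ℝ (e j) x = 0 := fun x hx => by
    have : Fact (Module.finrank ℝ (EuclideanSpace ℝ (Fin (m + 1))) = m + 1) := ⟨by simp⟩
    let b := OrthonormalBasis.fromOrthogonalSpanSingleton (𝕜 := ℝ) m hx
    refine ⟨fun j => b j, b.orthonormal.comp_linearIsometry (ℝ ∙ x)ᗮ.subtypeₗᵢ, fun j => ?_⟩
    rw [real_inner_comm]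
    exact Submodule.mem_orthogonal_singleton_iff_inner_right.1 (b j).2
  rcases eq_or_ne x 0 with rfl | hx
  -- For x = 0 the complement is too large, but a family orthogonal to any nonzero y will do.
  · obtain ⟨y, hy⟩ := exists_ne (0 : EuclideanSpace ℝ (Fin (m + 1)))
    obtain ⟨e, he, -⟩ := key y hy
    exact ⟨e, he, fun j => inner_zero_right _⟩
  · exact key x hx

lemma inner_deviation_mulVec (H : Matrix (Fin l) (Fin m) ℝ) (A : Matrix (Fin m) (Fin n) ℝ)
    (c : ℝ) (e : EuclideanSpace ℝ (Fin m)) (v : EuclideanSpace ℝ (Fin n))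
    (he : inner ℝ e (WithLp.toLp 2 (A *ᵥ v.ofLp)) = 0) :
    inner ℝ e (WithLp.toLp 2 ((c • (Hᵀ * H * A) - A) *ᵥ v.ofLp))
      = c * ((H *ᵥ (A *ᵥ v.ofLp)) ⬝ᵥ (H *ᵥ e.ofLp)) := by
  simp only [EuclideanSpace.inner_eq_star_dotProduct, star_trivial] at he ⊢
  rw [Matrix.sub_mulVec, sub_dotProduct, he, sub_zero, Matrix.smul_mulVec, smul_dotProduct,
    smul_eq_mul, ← Matrix.mulVec_mulVec, ← Matrix.mulVec_mulVec, Matrix.mulVec_transpose,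
    ← Matrix.dotProduct_mulVec]

/-- A sketch of `m + 1` coordinates to `l` misses the `m` directions orthogonal to its target. -/
lemma IsStandardGaussianMatrix.mul_norm_le_integral_norm_deviation {m : ℕ}
    {G : Ω → Matrix (Fin l) (Fin (m + 1)) ℝ} (hl : 1 ≤ l) (hG : IsStandardGaussianMatrix P G)
    (A : Matrix (Fin (m + 1)) (Fin n) ℝ) :
    2 / Real.pi * √(m / l) * ‖A‖
      ≤ ∫ ω, ‖(1 / (l : ℝ)) • ((G ω)ᵀ * G ω * A) - A‖ ∂P := by
  set I := ∫ ω, ‖(1 / (l : ℝ)) • ((G ω)ᵀ * G ω * A) - A‖ ∂P with hI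
  have hI0 : 0 ≤ I := integral_nonneg fun _ => norm_nonneg _
  have hc : 0 ≤ 2 / Real.pi * √((m : ℝ) / l) := by have := Real.pi_pos; positivity
  have hl0 : (0 : ℝ) < l := by exact_mod_cast hl
  rcases Nat.eq_zero_or_pos m with rfl | hm
  · simpa using hI0
  have hm0 : (0 : ℝ) < m := by exact_mod_cast hm
  -- Absorbing the constant into A turns the claim into a vectorwise operator norm bound.
  rw [← Real.norm_of_nonneg hc, ← norm_smul, Matrix.l2_opNorm_def]
  refine ContinuousLinearMap.opNorm_le_bound _ hI0 fun v => ?_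
  set x : EuclideanSpace ℝ (Fin (m + 1)) := WithLp.toLp 2 (A *ᵥ v.ofLp) with hx
  have hlhs : ‖((Matrix.toEuclideanLin.trans LinearMap.toContinuousLinearMap)
      ((2 / Real.pi * √((m : ℝ) / l)) • A)) v‖ = 2 / Real.pi * √((m : ℝ) / l) * ‖x‖ := by
    rw [map_smul, _root_.smul_apply, norm_smul, Real.norm_of_nonneg hc]
    rfl
  rw [hlhs]
  obtain ⟨e, he, hex⟩ := exists_orthonormal_orthogonal x
  have hdev := hG.integrable_deviation (1 / (l : ℝ)) A
  have hpt : ∀ ω, ∑ j, 1 / (l : ℝ) * |(G ω *ᵥ x.ofLp) ⬝ᵥ (G ω *ᵥ (e j).ofLp)|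
      ≤ √m * (‖(1 / (l : ℝ)) • ((G ω)ᵀ * G ω * A) - A‖ * ‖v‖) := fun ω => by
    have h := sum_abs_inner_le he
      (WithLp.toLp 2 (((1 / (l : ℝ)) • ((G ω)ᵀ * G ω * A) - A) *ᵥ v.ofLp))
    simp_rw [fun j => inner_deviation_mulVec (G ω) A (1 / (l : ℝ)) (e j) v (hex j), abs_mul,
      abs_of_nonneg (one_div_nonneg.2 hl0.le), Fintype.card_fin] at h
    refine h.trans ?_
    gcongr
    exact Matrix.l2_opNorm_mulVec _ v
  have hint : ∀ j, Integrable
      (fun ω => 1 / (l : ℝ) * |(G ω *ᵥ x.ofLp) ⬝ᵥ (G ω *ᵥ (e j).ofLp)|) P := fun j =>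
    (hG.integrable_mulVec_dotProduct_mulVec _ _).abs.const_mul _
  have hmono := integral_mono (integrable_finsetSum Finset.univ fun j _ => hint j)
    ((hdev.norm.mul_const ‖v‖).const_mul √m) hpt
  rw [integral_finsetSum _ fun j _ => hint j, integral_const_mul, integral_mul_const, ← hI] at hmono
  have hself : ∀ y : EuclideanSpace ℝ (Fin (m + 1)), √(y.ofLp ⬝ᵥ y.ofLp) = ‖y‖ := fun y => by
    rw [EuclideanSpace.norm_eq]
    simp [dotProduct, sq]
  have hterm : ∀ j, 1 / (l : ℝ) * (2 / Real.pi * √l * ‖x‖)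
      ≤ ∫ ω, 1 / (l : ℝ) * |(G ω *ᵥ x.ofLp) ⬝ᵥ (G ω *ᵥ (e j).ofLp)| ∂P := fun j => by
    rw [integral_const_mul]
    have h := hG.sqrt_mul_le_integral_abs_dotProduct (x := x.ofLp) (y := (e j).ofLp) (by
      simpa [EuclideanSpace.inner_eq_star_dotProduct] using hex j)
    rw [hself, hself, he.1 j, mul_one] at h
    gcongr
  have hsum := (Finset.sum_le_sum fun j (_ : j ∈ Finset.univ) => hterm j).trans hmono
  rw [Finset.sum_const, Finset.card_univ, Fintype.card_fin, nsmul_eq_mul] at hsum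
  have hsm : 0 < √(m : ℝ) := Real.sqrt_pos.2 hm0
  have hsl : 0 < √(l : ℝ) := Real.sqrt_pos.2 hl0
  refine le_of_mul_le_mul_left (le_of_eq_of_le ?_ hsum) hsm
  have hmm : √(m : ℝ) * √m = m := Real.mul_self_sqrt hm0.le
  have hll : 1 / (l : ℝ) = 1 / (√l * √l) := by rw [Real.mul_self_sqrt hl0.le]
  rw [Real.sqrt_div hm0.le, hll]
  nth_rewrite 3 [← hmm]
  have := Real.pi_pos
  field_simp

end Deviation

/-! ### Numerical comparison of constants and the main theorem. -/

/-- Comparison of the constant given by Gaussian first moments with the Beta type constant. -/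
lemma sqrt_div_le_two_div_pi_mul_sqrt {l m : ℕ} (hl : 1 ≤ l) (hlm : l ≤ m + 1) :
    √((((m + 1 : ℕ) : ℝ) - l) / (((m + 1 : ℕ) : ℝ) + 1)) ≤ 2 / Real.pi * √(m / l) := by
  have hl0 : (1 : ℝ) ≤ l := by exact_mod_cast hl
  have hlm' : (l : ℝ) ≤ m + 1 := by exact_mod_cast hlm
  have hpi := Real.pi_pos
  have hpi2 : Real.pi ^ 2 ≤ 12 := by nlinarith [Real.pi_lt_d2]
  have h3 : 1 / 3 ≤ (2 / Real.pi) ^ 2 := by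
    rw [div_pow, div_le_div_iff₀ (by norm_num) (by positivity)]
    linarith
  push_cast
  refine Real.sqrt_le_iff.2 ⟨by positivity, ?_⟩
  rw [mul_pow, Real.sq_sqrt (by positivity)]
  refine le_trans ?_ (mul_le_mul_of_nonneg_right h3 (by positivity))
  rw [div_mul_div_comm, div_le_div_iff₀ (by positivity) (by positivity)]
  rcases Nat.lt_or_ge m 1 with h | h
  · have : m = 0 := by omega
    subst this
    norm_num at hlm' ⊢
    nlinarith
  · have hm : (1 : ℝ) ≤ m := by exact_mod_cast h
    -- With M = m + 1 ≥ 2: 3l(M - l) ≤ 3M²/4 ≤ M² - 1.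
    nlinarith [sq_nonneg ((m : ℝ) + 1 - 2 * l)]

/-- For the quotient t ≤ 1 one has t ≤ √t ≤ 1 (also for t < 0, where `√t` is 0), and 1 - t =
(l+1)/(m+1) ≤ 2δ because l + 1 ≤ 2l. -/
lemma abs_sqrt_div_sub_one_le {l m : ℕ} {δ : ℝ} (hl : 1 ≤ l) (hlm : (l : ℝ) ≤ δ * m) :
    |√(((m : ℝ) - l) / ((m : ℝ) + 1)) - 1| ≤ 2 * δ := by
  have hl1 : (1 : ℝ) ≤ l := by exact_mod_cast hl
  have hm0 : (0 : ℝ) ≤ m := Nat.cast_nonneg m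
  have hm1 : (0 : ℝ) < (m : ℝ) + 1 := by linarith
  have hδ : 0 < δ := by
    by_contra! h
    nlinarith
  have hle : ((m : ℝ) - l) / (m + 1) ≤ 1 := by
    rw [div_le_one hm1]
    linarith
  have hge : 1 - 2 * δ ≤ ((m : ℝ) - l) / (m + 1) := by
    rw [le_div_iff₀ hm1]
    nlinarith
  have hsqrt : ((m : ℝ) - l) / (m + 1) ≤ √(((m : ℝ) - l) / (m + 1)) := by
    rcases le_total (((m : ℝ) - l) / (m + 1)) 0 with h | h
    · exact h.trans (Real.sqrt_nonneg _)
    · exact Real.le_sqrt_of_sq_le (by nlinarith)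
  rw [abs_sub_comm, abs_of_nonneg (sub_nonneg.2 (Real.sqrt_le_one.2 hle))]
  linarith

theorem theorem2 :
    -- the lower bound on the expected deviation
    (∀ {Ω : Type*} [MeasurableSpace Ω] (P : Measure Ω) [IsProbabilityMeasure P]
      (l m n : ℕ) (_ : 1 ≤ l) (_ : l ≤ m)
      (G : Ω → Matrix (Fin l) (Fin m) ℝ) (_ : IsStandardGaussianMatrix P G)
      (A : Matrix (Fin m) (Fin n) ℝ),
      Integrable (fun ω => ‖(1 / (l : ℝ)) • ((G ω)ᵀ * G ω * A) - A‖) P ∧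
        √(((m : ℝ) - l) / ((m : ℝ) + 1)) * ‖A‖ ≤
          ∫ ω, ‖(1 / (l : ℝ)) • ((G ω)ᵀ * G ω * A) - A‖ ∂P) ∧
    -- the bound is approximately `‖A‖` when `l` is much smaller than `m`
    (∀ ε : ℝ, 0 < ε → ∃ δ : ℝ, 0 < δ ∧
      ∀ (l m n : ℕ) (_ : 1 ≤ l) (_ : (l : ℝ) ≤ δ * m) (A : Matrix (Fin m) (Fin n) ℝ),
        |√(((m : ℝ) - l) / ((m : ℝ) + 1)) * ‖A‖ - ‖A‖| ≤ ε * ‖A‖) := by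
  refine ⟨fun P _ l m n hl hlm G hG A => ⟨(hG.integrable_deviation _ A).norm, ?_⟩,
    fun ε hε => ⟨ε / 2, half_pos hε, fun l m n hl hlm A => ?_⟩⟩
  · obtain ⟨m, rfl⟩ := Nat.exists_eq_succ_of_ne_zero (show m ≠ 0 by omega)
    exact (mul_le_mul_of_nonneg_right (sqrt_div_le_two_div_pi_mul_sqrt hl hlm)
      (norm_nonneg A)).trans (hG.mul_norm_le_integral_norm_deviation hl A)
  · rw [← sub_one_mul, abs_mul, abs_of_nonneg (norm_nonneg A)]
    gcongr
    linarith [abs_sqrt_div_sub_one_le hl hlm]
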